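/- **Theorem 4.3.** Let $n\ge 0$ be an integer and $f_1,\dots,f_n\in\mathbb C$. Let $d\mu_n(u)=\prod_{j=1}^n e^{-|u_j|^2}\,\frac{dx_j\,dy_j}{\pi}$ ($u_j=x_j+iy_j$) on $\mathbb C^n$, and let $\mathcal H\subset L^2(\mathbb C^n,\mu_n)$ be the Hilbert space of square integrable antiholomorphic functions $g(\bar u)$, $g$ entire on $\mathbb C^n$ (the holomorphic representation). On $\mathcal H$ let $a_j=\partial/\partial\bar u_j$ and $a_j^\dagger=$ multiplication by $\bar u_j$, each with its natural domain (all $g\in\mathcal H$ that it maps into $\mathcal H$), and let $$H=\sum_{j=1}^n\bigl(f_j a_j^\dagger+\bar f_j a_j\bigr),$$ meaning the closure of this sum of unbounded operators. Then $H$ is self-adjoint; there is exactly one strongly continuous one-parameter unitary group $(e^{itH})_{t\in\mathbb R}$ on $\mathcal H$ whose generator is $iH$ (with equality of domains); and for every $t\in\mathbb R$ the operator $e^{itH}$ has the integral kernel $$U(\bar u,v)=\exp\Bigl\{-\tfrac12t^2\sum_{j=1}^n\bar f_jf_j\Bigr\}\exp\sum_{j=1}^n\bigl(\bar u_jv_j+it\bar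 f_jv_j+itf_j\bar u_j\bigr),$$ that is, for all $g\in\mathcal H$ and all $u\in\mathbb C^n$, $$(e^{itH}g)(\bar u)=\int_{\mathbb C^n}U(\bar u,v)\,g(\bar v)\,d\mu_n(v),$$ the integral being absolutely convergent. -/

import Mathlib

open MeasureTheory Filter Topology
open scoped ENNReal ComplexConjugate

noncomputable section

/-- The Gaussian measure `∏ⱼ e^{-|uⱼ|²} dxⱼ dyⱼ / π` on `ℂⁿ`, where `uⱼ = xⱼ + i yⱼ`. -/
def bargmannMeasure (n : ℕ) : Measure (Fin n → ℂ) :=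
  volume.withDensity fun u => ENNReal.ofReal (∏ j, Real.exp (-‖u j‖ ^ 2) / Real.pi)

lemma bargmann_density_continuous (n : ℕ) :
    Continuous fun u : Fin n → ℂ => ∏ j, Real.exp (-‖u j‖ ^ 2) / Real.pi := by fun_prop

lemma bargmann_density_pos {n : ℕ} (u : Fin n → ℂ) :
    0 < ∏ j, Real.exp (-‖u j‖ ^ 2) / Real.pi := by positivity

lemma volume_absolutelyContinuous_bargmannMeasure (n : ℕ) :
    (volume : Measure (Fin n → ℂ)) ≪ bargmannMeasure n := by
  refine withDensity_absolutelyContinuous' ?_ ?_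
  · exact (bargmann_density_continuous n).measurable.ennreal_ofReal.aemeasurable
  · refine Eventually.of_forall fun u => ?_
    simpa using bargmann_density_pos u

lemma entire_eq_of_ae_eq {n : ℕ} {F G : (Fin n → ℂ) → ℂ} (hF : Differentiable ℂ F)
    (hG : Differentiable ℂ G)
    (h : (fun u => F (star u)) =ᵐ[bargmannMeasure n] fun u => G (star u)) : F = G := by
  have h2 := (volume_absolutelyContinuous_bargmannMeasure n).ae_eq h
  have h3 := (Continuous.ae_eq_iff_eq volume (hF.continuous.comp continuous_star)
    (hG.continuous.comp continuous_star)).1 h2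
  funext w
  simpa using congrFun h3 (star w)

lemma circle_bound {n : ℕ} {G : (Fin n → ℂ) → ℂ} (hG : Differentiable ℂ G) (w z : Fin n → ℂ) :
    ENNReal.ofReal (2 * Real.pi) * ‖G w‖ₑ ≤
      ∫⁻ θ in Set.Ioc 0 (2 * Real.pi), ‖G (w + circleMap 0 1 θ • z)‖ₑ := by
  have hd : Differentiable ℂ fun ζ : ℂ => G (w + ζ • z) := by fun_prop
  have h := DiffContOnCl.circleAverage (f := fun ζ : ℂ => G (w + ζ • z)) (c := 0) (R := 1)
    hd.diffContOnCl
  have h2pi : (0 : ℝ) < 2 * Real.pi := by positivity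
  rw [Real.circleAverage_def, intervalIntegral.integral_of_le h2pi.le] at h
  simp only [zero_smul, add_zero] at h
  rw [← h, enorm_smul, ← mul_assoc]
  have : ENNReal.ofReal (2 * Real.pi) * ‖(2 * Real.pi)⁻¹‖ₑ = 1 := by
    rw [Real.enorm_eq_ofReal (by positivity), ← ENNReal.ofReal_mul h2pi.le,
      mul_inv_cancel₀ h2pi.ne', ENNReal.ofReal_one]
  rw [this, one_mul]
  exact enorm_integral_le_lintegral_enorm _

lemma rotate_ball {n : ℕ} {f : (Fin n → ℂ) → ℝ≥0∞} (hf : Measurable f) (θ : ℝ) :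
    ∫⁻ z in Metric.closedBall (0 : Fin n → ℂ) 1, f (circleMap 0 1 θ • z) =
      ∫⁻ z in Metric.closedBall (0 : Fin n → ℂ) 1, f z := by
  have hmp : MeasurePreserving (fun z : Fin n → ℂ => circleMap 0 1 θ • z) volume volume := by
    have := volume_preserving_pi (ι := Fin n) (f := fun _ z => rotation (Circle.exp θ) z)
      fun _ => (rotation (Circle.exp θ)).measurePreserving
    have he : (fun z : Fin n → ℂ => circleMap 0 1 θ • z) =
        fun z j => rotation (Circle.exp θ) (z j) := by
      funext z j
      simp [circleMap]
    rw [he]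
    exact this
  have := hmp.setLIntegral_comp_preimage (s := Metric.closedBall 0 1)
    Metric.isClosed_closedBall.measurableSet hf
  rw [← this]
  congr 2
  ext z
  simp [norm_smul]

lemma ball_bound {n : ℕ} {G : (Fin n → ℂ) → ℂ} (hG : Differentiable ℂ G) (w : Fin n → ℂ) :
    volume (Metric.closedBall (0 : Fin n → ℂ) 1) * ‖G w‖ₑ ≤
      ∫⁻ z in Metric.closedBall w 1, ‖G z‖ₑ := by
  set B := Metric.closedBall (0 : Fin n → ℂ) 1
  have hc : Continuous G := hG.continuous
  have h1 : ∫⁻ _ in B, ENNReal.ofReal (2 * Real.pi) * ‖G w‖ₑ ≤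
      ∫⁻ z in B, ∫⁻ θ in Set.Ioc 0 (2 * Real.pi), ‖G (w + circleMap 0 1 θ • z)‖ₑ :=
    lintegral_mono fun z => circle_bound hG w z
  rw [lintegral_lintegral_swap (Continuous.aemeasurable (by
    simp only [Function.uncurry_def]; fun_prop))] at h1
  have h2 : ∀ θ : ℝ, ∫⁻ z in B, ‖G (w + circleMap 0 1 θ • z)‖ₑ = ∫⁻ z in B, ‖G (w + z)‖ₑ :=
    fun θ => rotate_ball (f := fun z => ‖G (w + z)‖ₑ) (Continuous.measurable (by fun_prop)) θ
  have h3 : ∫⁻ z in B, ‖G (w + z)‖ₑ = ∫⁻ z in Metric.closedBall w 1, ‖G z‖ₑ := by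
    have := (measurePreserving_add_left (volume : Measure (Fin n → ℂ)) w).setLIntegral_comp_preimage
      (s := Metric.closedBall w 1) Metric.isClosed_closedBall.measurableSet
      (f := fun z => ‖G z‖ₑ) (Continuous.measurable (by fun_prop))
    rw [← this]
    congr 2
    ext z
    simp [B]
  simp only [h2, h3, setLIntegral_const, Real.volume_Ioc, sub_zero] at h1
  have hp : ENNReal.ofReal (2 * Real.pi) ≠ 0 := by
    simp [Real.pi_pos]
  have h4 : ENNReal.ofReal (2 * Real.pi) * (volume B * ‖G w‖ₑ) ≤
      ENNReal.ofReal (2 * Real.pi) * ∫⁻ z in Metric.closedBall w 1, ‖G z‖ₑ := by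
    calc _ = ENNReal.ofReal (2 * Real.pi) * ‖G w‖ₑ * volume B := by ring
      _ ≤ _ := h1
      _ = _ := by ring
  exact (ENNReal.mul_le_mul_iff_right hp ENNReal.ofReal_ne_top).1 h4

lemma star_measurePreserving (n : ℕ) :
    MeasurePreserving (fun z : Fin n → ℂ => star z) volume volume :=
  volume_preserving_pi (ι := Fin n) (f := fun _ z => Complex.conjLIE z)
    fun _ => Complex.conjLIE.measurePreserving

/-- Point evaluations are bounded, locally uniformly, by the norm in `L²(μₙ)`. -/
lemma exists_eval_bound (n : ℕ) (R : ℝ) : ∃ C : ℝ, 0 ≤ C ∧ ∀ G : (Fin n → ℂ) → ℂ,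
    Differentiable ℂ G → ∀ g : Lp ℂ 2 (bargmannMeasure n),
    g =ᵐ[bargmannMeasure n] (fun u => G (star u)) → ∀ w, ‖w‖ ≤ R → ‖G w‖ ≤ C * ‖g‖ := by
  obtain ⟨c, hc, hcR⟩ : ∃ c : ℝ, 0 < c ∧ ∀ u : Fin n → ℂ, ‖u‖ ≤ R + 1 →
      c ≤ ∏ j, Real.exp (-‖u j‖ ^ 2) / Real.pi := by
    rcases (Metric.closedBall (0 : Fin n → ℂ) (R + 1)).eq_empty_or_nonempty with he | hne
    · refine ⟨1, one_pos, fun u hu => ?_⟩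
      have : u ∈ Metric.closedBall (0 : Fin n → ℂ) (R + 1) := by simpa using hu
      simp [he] at this
    · obtain ⟨x, -, hx⟩ := (isCompact_closedBall (0 : Fin n → ℂ) (R + 1)).exists_isMinOn hne
        (bargmann_density_continuous n).continuousOn
      exact ⟨_, bargmann_density_pos x, fun u hu => hx (by simpa using hu)⟩
  set V := volume (Metric.closedBall (0 : Fin n → ℂ) 1) with hV
  have hV0 : 0 < V := Metric.measure_closedBall_pos _ _ one_pos
  have hVt : V ≠ ∞ := measure_closedBall_lt_top.ne
  have hk : 0 < c * V.toReal := mul_pos hc (ENNReal.toReal_pos hV0.ne' hVt)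
  refine ⟨Real.sqrt (c * V.toReal)⁻¹, by positivity, fun G hG g hg w hw => ?_⟩
  have hGc : Continuous G := hG.continuous
  have e1 : V * ‖G w ^ 2‖ₑ ≤ ∫⁻ z in Metric.closedBall w 1, ‖G z ^ 2‖ₑ :=
    ball_bound (G := fun z => G z ^ 2) (by fun_prop) w
  have e2 : ∫⁻ z in Metric.closedBall w 1, ‖G z ^ 2‖ₑ =
      ∫⁻ u in Metric.closedBall (star w) 1, ‖G (star u) ^ 2‖ₑ := by
    rw [← (star_measurePreserving n).setLIntegral_comp_preimage
      Metric.isClosed_closedBall.measurableSet (Continuous.measurable (by fun_prop))]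
    congr 2
    ext u
    simp only [Set.mem_preimage, Metric.mem_closedBall]
    rw [← dist_star_star, star_star]
  have e3 : ENNReal.ofReal c * ∫⁻ u in Metric.closedBall (star w) 1, ‖G (star u) ^ 2‖ₑ ≤
      ∫⁻ u, ‖G (star u) ^ 2‖ₑ ∂bargmannMeasure n := by
    rw [bargmannMeasure, lintegral_withDensity_eq_lintegral_mul _
      (bargmann_density_continuous n).measurable.ennreal_ofReal (Continuous.measurable (by fun_prop)),
      ← lintegral_const_mul _ (Continuous.measurable (by fun_prop))]
    refine le_trans ?_ (setLIntegral_le_lintegral (Metric.closedBall (star w) 1) _)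
    refine setLIntegral_mono' Metric.isClosed_closedBall.measurableSet fun u hu => ?_
    simp only [Pi.mul_apply]
    gcongr
    apply hcR
    have h1 : dist u (star w) ≤ 1 := hu
    rw [dist_eq_norm] at h1
    have h2 : ‖u‖ ≤ ‖u - star w‖ + ‖star w‖ := by simpa using norm_add_le (u - star w) (star w)
    rw [norm_star] at h2
    linarith
  have e4 : ∫⁻ u, ‖G (star u) ^ 2‖ₑ ∂bargmannMeasure n = ‖g‖ₑ ^ 2 := by
    rw [Lp.enorm_def, eLpNorm_congr_ae hg]
    have := eLpNorm_nnreal_pow_eq_lintegral (μ := bargmannMeasure n) (p := 2)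
      (f := fun u => G (star u)) (by norm_num)
    simpa [enorm_pow] using this.symm
  have e5 : ENNReal.ofReal c * (V * ‖G w ^ 2‖ₑ) ≤ ‖g‖ₑ ^ 2 := by
    rw [← e4]
    refine le_trans ?_ e3
    gcongr
    rw [← e2]
    exact e1
  have e6 : c * V.toReal * ‖G w‖ ^ 2 ≤ ‖g‖ ^ 2 := by
    have := ENNReal.toReal_mono (by finiteness) e5
    simpa [ENNReal.toReal_mul, hc.le, mul_assoc] using this
  have e7 : ‖G w‖ ^ 2 ≤ (c * V.toReal)⁻¹ * ‖g‖ ^ 2 := by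
    rw [← div_eq_inv_mul, le_div_iff₀ hk]
    linarith
  rw [← abs_norm (G w), ← Real.sqrt_sq_eq_abs, ← Real.sqrt_sq (norm_nonneg g),
    ← Real.sqrt_mul (by positivity)]
  exact Real.sqrt_le_sqrt e7

lemma exists_fderiv_bound (n : ℕ) (R : ℝ) : ∃ C : ℝ, 0 ≤ C ∧ ∀ G : (Fin n → ℂ) → ℂ,
    Differentiable ℂ G → ∀ g : Lp ℂ 2 (bargmannMeasure n),
    g =ᵐ[bargmannMeasure n] (fun u => G (star u)) →
    ∀ w, ‖w‖ ≤ R → ‖fderiv ℂ G w‖ ≤ C * ‖g‖ := by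
  obtain ⟨C, hC, h⟩ := exists_eval_bound n (R + 1)
  refine ⟨C, hC, fun G hG g hg w hw => ?_⟩
  refine ContinuousLinearMap.opNorm_le_bound _ (by positivity) fun v => ?_
  rcases eq_or_ne v 0 with rfl | hv
  · simp
  have hv' : 0 < ‖v‖ := norm_pos_iff.2 hv
  have hd : HasDerivAt (fun ζ : ℂ => G (w + ζ • v)) (fderiv ℂ G w v) 0 := by
    have h1 : HasDerivAt (fun ζ : ℂ => w + ζ • v) v 0 := by
      simpa using ((hasDerivAt_id (0 : ℂ)).smul_const v).const_add w
    have h2 : HasFDerivAt G (fderiv ℂ G w) (w + (0 : ℂ) • v) := by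
      simpa using (hG w).hasFDerivAt
    exact h2.comp_hasDerivAt (0 : ℂ) h1
  have hdiff : Differentiable ℂ fun ζ : ℂ => G (w + ζ • v) := by fun_prop
  have := Complex.norm_deriv_le_of_forall_mem_sphere_norm_le (c := 0) (R := ‖v‖⁻¹)
    (C := C * ‖g‖) (by positivity) hdiff.diffContOnCl (fun ζ hζ => by
      refine h G hG g hg _ ?_
      have h1 : ‖ζ‖ = ‖v‖⁻¹ := by simpa using hζ
      refine (norm_add_le _ _).trans ?_
      rw [norm_smul, h1, inv_mul_cancel₀ hv'.ne']
      linarith)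
  rw [hd.deriv, div_inv_eq_mul] at this
  exact this

/-- The Hilbert space of the holomorphic representation: the square integrable antiholomorphic
functions `u ↦ G(ū)`, `G` entire, with `⟨f, g⟩ = ∫ conj (f(ū)) g(ū) dμₙ(u)`. -/
def HolomorphicSpace (n : ℕ) : Submodule ℂ (Lp ℂ 2 (bargmannMeasure n)) where
  carrier := {g | ∃ G : (Fin n → ℂ) → ℂ, Differentiable ℂ G ∧
    g =ᵐ[bargmannMeasure n] fun u => G (star u)}
  zero_mem' := ⟨0, differentiable_const 0, Lp.coeFn_zero _ _ _⟩
  add_mem' := by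
    rintro f g ⟨F, hF, hf⟩ ⟨G, hG, hg⟩
    exact ⟨F + G, hF.add hG, (Lp.coeFn_add f g).trans (hf.add hg)⟩
  smul_mem' := by
    rintro c g ⟨G, hG, hg⟩
    exact ⟨c • G, hG.const_smul c, (Lp.coeFn_smul c g).trans (hg.const_smul c)⟩

lemma isClosed_holomorphicSpace (n : ℕ) :
    IsClosed (HolomorphicSpace n : Set (Lp ℂ 2 (bargmannMeasure n))) := by
  refine IsSeqClosed.isClosed fun g g₀ hg hlim => ?_
  choose G hG hgG using hg
  have hsub : ∀ k m, ((g k - g m : Lp ℂ 2 (bargmannMeasure n)) : (Fin n → ℂ) → ℂ)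
      =ᵐ[bargmannMeasure n] fun u => (G k - G m) (star u) := fun k m =>
    (Lp.coeFn_sub _ _).trans ((hgG k).sub (hgG m))
  have hcau : CauchySeq g := hlim.cauchySeq
  -- uniform Cauchy estimate from a bound by the norm
  have key : ∀ C : ℝ, 0 ≤ C → ∀ ε > 0, ∃ N, ∀ k ≥ N, ∀ m ≥ N, C * ‖g k - g m‖ < ε := by
    intro C hC ε hε
    obtain ⟨N, hN⟩ := Metric.cauchySeq_iff.1 hcau (ε / (C + 1)) (by positivity)
    refine ⟨N, fun k hk m hm => ?_⟩
    have := hN k hk m hm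
    rw [dist_eq_norm, lt_div_iff₀ (by positivity)] at this
    nlinarith [norm_nonneg (g k - g m)]
  have hval : ∀ w, CauchySeq fun k => G k w := by
    intro w
    obtain ⟨C, hC, h⟩ := exists_eval_bound n ‖w‖
    refine Metric.cauchySeq_iff.2 fun ε hε => ?_
    obtain ⟨N, hN⟩ := key C hC ε hε
    refine ⟨N, fun k hk m hm => ?_⟩
    rw [dist_eq_norm]
    exact (h _ ((hG k).sub (hG m)) _ (hsub k m) w le_rfl).trans_lt (hN k hk m hm)
  have hder : ∀ R : ℝ, UniformCauchySeqOn (fun k => fderiv ℂ (G k)) atTop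
      (Metric.ball (0 : Fin n → ℂ) R) := by
    intro R
    obtain ⟨C, hC, h⟩ := exists_fderiv_bound n R
    refine Metric.uniformCauchySeqOn_iff.2 fun ε hε => ?_
    obtain ⟨N, hN⟩ := key C hC ε hε
    refine ⟨N, fun k hk m hm w hw => ?_⟩
    have hw' : ‖w‖ ≤ R := by
      have : ‖w‖ < R := by simpa using hw
      exact this.le
    have h1 := h _ ((hG k).sub (hG m)) _ (hsub k m) w hw'
    rw [fderiv_sub (hG k w) (hG m w)] at h1
    rw [dist_eq_norm]
    exact h1.trans_lt (hN k hk m hm)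
  choose G₀ hG₀ using fun w => cauchySeq_tendsto_of_complete (hval w)
  have hderc : ∀ w, CauchySeq fun k => fderiv ℂ (G k) w := fun w =>
    (hder (‖w‖ + 1)).cauchySeq (by simp)
  choose D hD using fun w => cauchySeq_tendsto_of_complete (hderc w)
  refine ⟨G₀, fun w => ?_, ?_⟩
  · refine (hasFDerivAt_of_tendstoUniformlyOn (l := atTop) (f := G)
      (f' := fun k => fderiv ℂ (G k)) (g' := D)
      (s := Metric.ball (0 : Fin n → ℂ) (‖w‖ + 1)) Metric.isOpen_ball
      ((hder _).tendstoUniformlyOn_of_tendsto fun x _ => hD x)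
      (fun k x _ => (hG k x).hasFDerivAt) (fun x _ => hG₀ x) (x := w)
      (by simp)).differentiableAt
  · obtain ⟨ns, hns, hae⟩ := (tendstoInMeasure_of_tendsto_Lp hlim).exists_seq_tendsto_ae
    filter_upwards [hae, ae_all_iff.2 hgG] with u hu hu'
    refine tendsto_nhds_unique hu ?_
    simp only [hu']
    exact (hG₀ (star u)).comp hns.tendsto_atTop

instance completeSpace_holomorphicSpace (n : ℕ) : CompleteSpace (HolomorphicSpace n) :=
  (isClosed_holomorphicSpace n).completeSpace_coe

/-- The entire function `G` with `g(u) = G(ū)`, for `g` in the holomorphic representation space. -/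
def entirePart {n : ℕ} (g : HolomorphicSpace n) : (Fin n → ℂ) → ℂ := g.2.choose

lemma differentiable_entirePart {n : ℕ} (g : HolomorphicSpace n) :
    Differentiable ℂ (entirePart g) := g.2.choose_spec.1

lemma coeFn_ae_eq_entirePart {n : ℕ} (g : HolomorphicSpace n) :
    (g : Lp ℂ 2 (bargmannMeasure n)) =ᵐ[bargmannMeasure n] fun u => entirePart g (star u) :=
  g.2.choose_spec.2

lemma entirePart_eq_of_ae_eq {n : ℕ} (g : HolomorphicSpace n) {G : (Fin n → ℂ) → ℂ}
    (hG : Differentiable ℂ G)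
    (h : (g : Lp ℂ 2 (bargmannMeasure n)) =ᵐ[bargmannMeasure n] fun u => G (star u)) :
    entirePart g = G :=
  entire_eq_of_ae_eq (differentiable_entirePart g) hG ((coeFn_ae_eq_entirePart g).symm.trans h)

lemma entirePart_injective (n : ℕ) :
    Function.Injective (entirePart : HolomorphicSpace n → (Fin n → ℂ) → ℂ) := fun f g h => by
  refine Subtype.ext (Lp.ext ?_)
  refine (coeFn_ae_eq_entirePart f).trans ?_
  rw [h]
  exact (coeFn_ae_eq_entirePart g).symm

lemma entirePart_add {n : ℕ} (f g : HolomorphicSpace n) :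
    entirePart (f + g) = entirePart f + entirePart g :=
  entirePart_eq_of_ae_eq _ ((differentiable_entirePart f).add (differentiable_entirePart g))
    ((Lp.coeFn_add _ _).trans ((coeFn_ae_eq_entirePart f).add (coeFn_ae_eq_entirePart g)))

lemma entirePart_smul {n : ℕ} (c : ℂ) (g : HolomorphicSpace n) :
    entirePart (c • g) = c • entirePart g :=
  entirePart_eq_of_ae_eq _ ((differentiable_entirePart g).const_smul c)
    ((Lp.coeFn_smul _ _).trans ((coeFn_ae_eq_entirePart g).const_smul c))

lemma entirePart_zero (n : ℕ) : entirePart (0 : HolomorphicSpace n) = 0 := by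
  simpa using entirePart_smul 0 (0 : HolomorphicSpace n)

/-- The natural domain `{g | D g is again in the space}` of an operation `D` which is linear on
entire functions of `ū`. -/
def maximalDomain {n : ℕ} (D : ((Fin n → ℂ) → ℂ) → (Fin n → ℂ) → ℂ)
    (hadd : ∀ F G, Differentiable ℂ F → Differentiable ℂ G → D (F + G) = D F + D G)
    (hsmul : ∀ (c : ℂ) F, Differentiable ℂ F → D (c • F) = c • D F) :
    Submodule ℂ (HolomorphicSpace n) where
  carrier := {g | ∃ h : HolomorphicSpace n, entirePart h = D (entirePart g)}
  zero_mem' := ⟨0, by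
    have := hsmul 0 0 (differentiable_const 0)
    simp only [zero_smul] at this
    rw [entirePart_zero, this]⟩
  add_mem' := by
    rintro f g ⟨f', hf⟩ ⟨g', hg⟩
    exact ⟨f' + g', by
      rw [entirePart_add, entirePart_add, hf, hg,
        hadd _ _ (differentiable_entirePart f) (differentiable_entirePart g)]⟩
  smul_mem' := by
    rintro c g ⟨g', hg⟩
    exact ⟨c • g', by
      rw [entirePart_smul, entirePart_smul, hg, hsmul _ _ (differentiable_entirePart g)]⟩

/-- The operator `g ↦ D g` on the holomorphic representation space with its natural (maximal)
domain. -/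
def maximalOperator {n : ℕ} (D : ((Fin n → ℂ) → ℂ) → (Fin n → ℂ) → ℂ)
    (hadd : ∀ F G, Differentiable ℂ F → Differentiable ℂ G → D (F + G) = D F + D G)
    (hsmul : ∀ (c : ℂ) F, Differentiable ℂ F → D (c • F) = c • D F) :
    HolomorphicSpace n →ₗ.[ℂ] HolomorphicSpace n where
  domain := maximalDomain D hadd hsmul
  toFun :=
    { toFun := fun g => Classical.choose g.2
      map_add' := fun f g => by
        have hf := Classical.choose_spec f.2
        have hg := Classical.choose_spec g.2
        have hfg := Classical.choose_spec (f + g).2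
        generalize Classical.choose f.2 = f' at hf ⊢
        generalize Classical.choose g.2 = g' at hg ⊢
        generalize Classical.choose (f + g).2 = k at hfg ⊢
        apply entirePart_injective n
        rw [entirePart_add, hf, hg, hfg, Submodule.coe_add, entirePart_add,
          hadd _ _ (differentiable_entirePart _) (differentiable_entirePart _)]
      map_smul' := fun c g => by
        have hg := Classical.choose_spec g.2
        have hcg := Classical.choose_spec (c • g).2
        generalize Classical.choose g.2 = g' at hg ⊢
        generalize Classical.choose (c • g).2 = k at hcg ⊢
        apply entirePart_injective n
        rw [RingHom.id_apply, entirePart_smul, hg, hcg, Submodule.coe_smul, entirePart_smul,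
          hsmul _ _ (differentiable_entirePart _)] }

lemma entirePart_maximalOperator {n : ℕ} (D : ((Fin n → ℂ) → ℂ) → (Fin n → ℂ) → ℂ)
    (hadd : ∀ F G, Differentiable ℂ F → Differentiable ℂ G → D (F + G) = D F + D G)
    (hsmul : ∀ (c : ℂ) F, Differentiable ℂ F → D (c • F) = c • D F)
    (g : (maximalOperator D hadd hsmul).domain) :
    entirePart (maximalOperator D hadd hsmul g) = D (entirePart (g : HolomorphicSpace n)) :=
  Classical.choose_spec g.2

/-- The annihilation operator `aⱼ = ∂/∂ūⱼ`. -/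
def annihilation {n : ℕ} (j : Fin n) : HolomorphicSpace n →ₗ.[ℂ] HolomorphicSpace n :=
  maximalOperator (fun G w => fderiv ℂ G w (Pi.single j 1))
    (fun F G hF hG => by funext w; simp [fderiv_add (hF w) (hG w)])
    (fun c F hF => by funext w; simp [fderiv_const_smul (hF w)])

/-- The creation operator `aⱼ†`, multiplication by `ūⱼ`. -/
def creation {n : ℕ} (j : Fin n) : HolomorphicSpace n →ₗ.[ℂ] HolomorphicSpace n :=
  maximalOperator (fun G w => w j * G w)
    (fun F G _ _ => by funext w; simp [mul_add])
    (fun c F _ => by funext w; simp [mul_left_comm])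

/-- The linear Hamiltonian `H = ∑ⱼ (fⱼ aⱼ† + f̄ⱼ aⱼ)`: the closure of the sum of unbounded operators
(whose domain is the intersection of the domains of the summands). -/
def linearHamiltonian {n : ℕ} (f : Fin n → ℂ) : HolomorphicSpace n →ₗ.[ℂ] HolomorphicSpace n :=
  (∑ j, (f j • creation j + conj (f j) • annihilation j)).closure

/-- `U(t) = e^{itH}`, `t ∈ ℝ`, for an unbounded operator `H` on a Hilbert space: `U` is a strongly
continuous one-parameter group of unitary operators whose infinitesimal generator is `iH`,
including the equality of domains. -/
structure IsUnitaryGroupExp {E : Type*} [NormedAddCommGroup E] [InnerProductSpace ℂ E]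
    (H : E →ₗ.[ℂ] E) (U : ℝ → E ≃ₗᵢ[ℂ] E) : Prop where
  map_zero : ∀ x, U 0 x = x
  map_add : ∀ s t x, U (s + t) x = U s (U t x)
  continuous_apply : ∀ x, Continuous fun t => U t x
  generator : ∀ x y, (x, y) ∈ H.graph ↔
    Tendsto (fun t : ℝ => (t : ℂ)⁻¹ • (U t x - x)) (𝓝[≠] 0) (𝓝 (Complex.I • y))

/-- `K` is the integral kernel of the operator `A` in the holomorphic representation:
`(A g)(ū) = ∫ K(ū, v) g(v̄) dμₙ(v)` for all `g` and all `u`, the integral being absolutely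
convergent. -/
def HasIntegralKernel {n : ℕ} (A : HolomorphicSpace n → HolomorphicSpace n)
    (K : (Fin n → ℂ) → (Fin n → ℂ) → ℂ) : Prop :=
  ∀ (g : HolomorphicSpace n) (u : Fin n → ℂ),
    Integrable (fun v => K (star u) v * entirePart g (star v)) (bargmannMeasure n) ∧
    entirePart (A g) (star u) =
      ∫ v, K (star u) v * entirePart g (star v) ∂bargmannMeasure n

end

/-! Since the commutators `[a_j, a_j†]` are scalars, `e^{itH}` should factor as `e^{-t²|f|²/2} e^{it
f·a†} e^{it f̄·a}`, which sends an entire function `G` to `w ↦ e^{-t²|f|²/2} e^{it f·w} G(w + it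
f̄)`. This formula, `displaceFun`, is taken as the definition of the group, and everything about `H`
is read off from it; neither Stone's theorem nor integration by parts is needed.

Unitarity is the change of variables `u ↦ u + it f̄` in the Gaussian integral. Evaluation at a point
is the inner product with a coherent state (`inner_coherentState`), so pointwise differentiation in
`t` is weak differentiation against a total family; `hasGenerator_of_inner` makes it strong. Hence
the generator is `i` times the maximal operator `A` of the expression `∑ (f_j w_j + f̄_j ∂_j)`
(`hasGenerator_displacement_iff`), and `A` is symmetric.

The sum `T` of the ladder operators lies in `A`, and its domain contains the coherent states.
Testing `T*` against them gives `T* ≤ A`, and `LinearPMap.isSelfAdjoint_closure_of_adjoint_le`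
concludes that the closure of `T` is `A` and is self-adjoint. The integral kernel is the reproducing
kernel at the translated point. -/

noncomputable section

/-! ### Adjoints and closures of linear relations. -/

section UnboundedOperators

variable {E : Type*} [NormedAddCommGroup E] [InnerProductSpace ℂ E]

lemma Submodule.adjoint_antitone {S T : Submodule ℂ (E × E)} (h : S ≤ T) :
    T.adjoint ≤ S.adjoint := fun x hx => by
  rw [Submodule.mem_adjoint_iff] at hx ⊢
  exact fun a b hab => hx a b (h hab)

/-- The rotation `(p, q) ↦ (q, -p)` carries `Sᗮ` into the adjoint of `S`, so a point of the double
adjoint is orthogonal to `Sᗮ`, and `Sᗮᗮ` is the closure. The passage to `WithLp 2` gives `E × E` its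
Hilbert space structure. -/
lemma Submodule.adjoint_adjoint_le_topologicalClosure [CompleteSpace E] (S : Submodule ℂ (E × E)) :
    S.adjoint.adjoint ≤ S.topologicalClosure := by
  rintro ⟨x, y⟩ hxy
  rw [Submodule.mem_adjoint_iff] at hxy
  set e := (WithLp.linearEquiv 2 ℂ (E × E))
  set S' : Submodule ℂ (WithLp 2 (E × E)) := S.map e.symm.toLinearMap with hS'
  have h1 : WithLp.toLp 2 (x, y) ∈ S'ᗮᗮ := by
    rw [Submodule.mem_orthogonal]
    intro b hb
    rw [Submodule.mem_orthogonal] at hb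
    have hb' : (b.snd, -b.fst) ∈ S.adjoint := by
      rw [Submodule.mem_adjoint_iff]
      intro p q hpq
      have := hb (WithLp.toLp 2 (p, q)) ⟨(p, q), hpq, rfl⟩
      rw [WithLp.prod_inner_apply] at this
      simpa [add_comm] using this
    have := hxy _ _ hb'
    rw [WithLp.prod_inner_apply]
    simp only [inner_neg_left] at this
    change inner ℂ b.fst x + inner ℂ b.snd y = 0
    linear_combination -this
  rw [Submodule.orthogonal_orthogonal_eq_closure] at h1
  have h2 : (x, y) ∈ closure (WithLp.ofLp '' (S' : Set (WithLp 2 (E × E)))) :=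
    image_closure_subset_closure_image (WithLp.prod_continuous_ofLp 2 E E) ⟨_, h1, rfl⟩
  have h3 : WithLp.ofLp '' (S' : Set (WithLp 2 (E × E))) = (S : Set (E × E)) := by
    ext p
    constructor
    · rintro ⟨_, ⟨q, hq, rfl⟩, rfl⟩
      exact hq
    · intro hp
      exact ⟨WithLp.toLp 2 p, ⟨p, hp, rfl⟩, rfl⟩
  rw [h3] at h2
  exact h2

/-- If a densely defined operator `T` is contained in a symmetric relation `A` which contains the
adjoint of `T`, then `T` is essentially self-adjoint and `A` is the graph of its closure. -/
theorem LinearPMap.isSelfAdjoint_closure_of_adjoint_le [CompleteSpace E] {T : E →ₗ.[ℂ] E}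
    {A : Submodule ℂ (E × E)}
    (hT : Dense (T.domain : Set E)) (hTA : T.graph ≤ A) (hA : A ≤ A.adjoint)
    (hadj : T.graph.adjoint ≤ A) : IsSelfAdjoint T.closure ∧ T.closure.graph = A := by
  have h1 : T.graph.adjoint = A :=
    le_antisymm hadj (hA.trans (Submodule.adjoint_antitone hTA))
  have h2 : A.adjoint = A :=
    le_antisymm ((Submodule.adjoint_antitone hTA).trans hadj) hA
  have hgr : T.adjoint.graph = A := (LinearPMap.adjoint_graph_eq_graph_adjoint hT).trans h1
  have hle : T ≤ T.adjoint := LinearPMap.le_of_le_graph (hTA.trans hgr.ge)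
  have hcl : T.adjoint.IsClosed := LinearPMap.adjoint_isClosed hT
  have hclos : T.IsClosable := LinearPMap.isClosable_iff_exists_closed_extension.2 ⟨_, hcl, hle⟩
  -- `A` is closed, being the graph of an adjoint; conversely `A = A* = T**` lies in the closure of
  -- `T`.
  have h3 : T.graph.topologicalClosure = A := by
    refine le_antisymm (Submodule.topologicalClosure_minimal _ hTA ?_) ?_
    · rw [← hgr]
      exact hcl
    · have := T.graph.adjoint_adjoint_le_topologicalClosure
      rwa [h1, h2] at this
  have h4 : T.closure.graph = A := by rw [← hclos.graph_closure_eq_closure_graph, h3]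
  refine ⟨?_, h4⟩
  have hd : Dense (T.closure.domain : Set E) := hT.mono T.le_closure.1
  rw [LinearPMap.isSelfAdjoint_def]
  apply LinearPMap.eq_of_eq_graph
  rw [LinearPMap.adjoint_graph_eq_graph_adjoint hd, h4, h2]

end UnboundedOperators

/-! ### One-parameter unitary groups and their generators. -/

section UnitaryGroups

variable {E : Type*} [NormedAddCommGroup E] [InnerProductSpace ℂ E] {U V : ℝ → E ≃ₗᵢ[ℂ] E}

/-- `x` is in the domain of the infinitesimal generator of `U`, which maps it to `i y`. -/
def HasGenerator (U : ℝ → E ≃ₗᵢ[ℂ] E) (x y : E) : Prop :=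
  Tendsto (fun t : ℝ => (t : ℂ)⁻¹ • (U t x - x)) (𝓝[≠] 0) (𝓝 (Complex.I • y))

lemma unitaryGroup_inner_left (h0 : ∀ x, U 0 x = x) (hadd : ∀ s t x, U (s + t) x = U s (U t x))
    (t : ℝ) (x y : E) : inner ℂ (U t x) y = inner ℂ x (U (-t) y) := by
  rw [← (U t).inner_map_map x, ← hadd, add_neg_cancel, h0]

lemma HasGenerator.comp_neg {x y : E} (h : HasGenerator U x y) :
    Tendsto (fun t : ℝ => (t : ℂ)⁻¹ • (U (-t) x - x)) (𝓝[≠] 0) (𝓝 (-(Complex.I • y))) := by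
  have h1 : Tendsto (fun t : ℝ => -t) (𝓝[≠] 0) (𝓝[≠] 0) := by
    refine tendsto_nhdsWithin_iff.2 ⟨?_, ?_⟩
    · have : Tendsto (fun t : ℝ => -t) (𝓝 0) (𝓝 0) := by
        simpa using (continuous_neg (G := ℝ)).tendsto 0
      exact this.mono_left nhdsWithin_le_nhds
    · filter_upwards [self_mem_nhdsWithin] with t ht
      simpa using ht
  have h2 := (h.comp h1).neg
  refine h2.congr fun t => ?_
  simp [neg_smul, inv_neg]

/-- Differentiate `⟨U t x, y⟩ = ⟨x, U (-t) y⟩` at `t = 0`. -/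
lemma HasGenerator.inner_symm (h0 : ∀ x, U 0 x = x) (hadd : ∀ s t x, U (s + t) x = U s (U t x))
    {x x' y y' : E} (hx : HasGenerator U x x') (hy : HasGenerator U y y') :
    inner ℂ x' y = inner ℂ x y' := by
  have h1 := hx.inner (tendsto_const_nhds (x := y)) (𝕜 := ℂ)
  have h2 := (tendsto_const_nhds (x := x)).inner hy.comp_neg (𝕜 := ℂ)
  have h3 := tendsto_nhds_unique (h1.congr fun t => ?_) h2
  · simp only [inner_smul_left, inner_neg_right, inner_smul_right, Complex.conj_I] at h3
    have := congrArg (Complex.I * ·) h3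
    simp only [← mul_assoc, mul_neg, Complex.I_mul_I] at this
    simpa using this
  · rw [inner_smul_left, inner_smul_right, inner_sub_left, inner_sub_right,
      unitaryGroup_inner_left h0 hadd]
    simp

lemma HasGenerator.apply (hadd : ∀ s t x, U (s + t) x = U s (U t x)) {x y : E}
    (h : HasGenerator U x y) (s : ℝ) : HasGenerator U (U s x) (U s y) := by
  have h1 := ((U s).continuous.tendsto _).comp h
  rw [map_smul] at h1
  refine h1.congr fun t => ?_
  simp only [Function.comp_apply, map_smul, map_sub, ← hadd, add_comm s t]

lemma HasGenerator.hasDerivAt (hadd : ∀ s t x, U (s + t) x = U s (U t x)) {x y : E}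
    (h : HasGenerator U x y) (s : ℝ) :
    HasDerivAt (fun t => U t x) (Complex.I • U s y) s := by
  rw [hasDerivAt_iff_tendsto_slope_zero]
  refine (h.apply hadd s).congr fun t => ?_
  rw [← hadd, add_comm t s, ← Complex.ofReal_inv, Complex.coe_smul]

/-- Moving `U t` to the left argument leaves `z` arbitrary: only `x` has to be in the domain of the
generator. This is what makes the adjoint accessible later. -/
lemma HasGenerator.hasDerivAt_inner (h0 : ∀ x, U 0 x = x)
    (hadd : ∀ s t x, U (s + t) x = U s (U t x)) {x y : E} (h : HasGenerator U x y) (z : E) :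
    HasDerivAt (fun t => inner ℂ x (U t z)) (Complex.I * inner ℂ y z) 0 := by
  rw [hasDerivAt_iff_tendsto_slope_zero]
  have h1 := h.comp_neg.inner (tendsto_const_nhds (x := z)) (𝕜 := ℂ)
  rw [inner_neg_left, inner_smul_left, Complex.conj_I, neg_mul, neg_neg] at h1
  refine h1.congr fun t => ?_
  rw [inner_smul_left, inner_sub_left, unitaryGroup_inner_left h0 hadd, neg_neg, zero_add, h0,
    map_inv₀, Complex.conj_ofReal, ← Complex.ofReal_inv, Complex.real_smul]

/-- A unitary group is determined by the restriction of its generator to a dense set. -/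
theorem unitaryGroup_unique (hU0 : ∀ x, U 0 x = x) (hU : ∀ s t x, U (s + t) x = U s (U t x))
    (hV0 : ∀ x, V 0 x = x) (hV : ∀ s t x, V (s + t) x = V s (V t x)) {D : Set E} (hD : Dense D)
    (h : ∀ x ∈ D, ∃ y, HasGenerator U x y ∧ HasGenerator V x y)
    (hUV : ∀ x y, HasGenerator V x y → HasGenerator U x y) : V = U := by
  -- The derivative of `⟨V s x, U s y⟩` vanishes by symmetry of the generator of `U`; `hUV` is what
  -- puts `V s x` in its domain.
  have key : ∀ x ∈ D, ∀ y ∈ D, ∀ t, inner ℂ (V t x) (U t y) = inner ℂ x y := by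
    intro x hx y hy t
    obtain ⟨x', -, hx'⟩ := h x hx
    obtain ⟨y', hy', -⟩ := h y hy
    have hd : ∀ s, HasDerivAt (fun s => inner ℂ (V s x) (U s y)) 0 s := by
      intro s
      have h1 := (hx'.hasDerivAt hV s).inner ℂ (hy'.hasDerivAt hU s)
      have h2 := HasGenerator.inner_symm hU0 hU (hUV _ _ (hx'.apply hV s)) (hy'.apply hU s)
      have h3 : inner ℂ (V s x) (Complex.I • U s y') + inner ℂ (Complex.I • V s x') (U s y) = 0 := by
        rw [inner_smul_left, inner_smul_right, h2]
        simp
      rwa [h3] at h1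
    have := is_const_of_deriv_eq_zero (fun s => (hd s).differentiableAt) (fun s => (hd s).deriv) t 0
    simpa [hU0, hV0] using this
  have key2 : ∀ y ∈ D, ∀ t, U t y = V t y := by
    intro y hy t
    have h1 : V (-t) (U t y) = y := by
      refine hD.eq_of_inner_right ℂ fun x hx => ?_
      rw [← key x hx y hy t, unitaryGroup_inner_left hV0 hV]
    rw [← h1, ← hV, add_neg_cancel, hV0, h1]
  funext t
  ext x
  exact congrFun (((V t).continuous.ext_on hD (U t).continuous fun y hy => (key2 y hy t).symm)) x

/-- Differentiability of the matrix elements of `U t x` against a total family suffices for `x` to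
be in the domain of the generator, if the derivative comes from a vector. -/
theorem hasGenerator_of_inner [CompleteSpace E] (h0 : ∀ x, U 0 x = x)
    {ι : Type*} {k : ι → E}
    (hk : ∀ x, (∀ i, inner ℂ (k i) x = 0) → x = 0) {x y : E} (hc : Continuous fun t => U t y)
    (h : ∀ i t, HasDerivAt (fun s => inner ℂ (k i) (U s x)) (Complex.I * inner ℂ (k i) (U t y)) t) :
    HasGenerator U x y := by
  have hc' : Continuous fun t => Complex.I • U t y := hc.const_smul _
  -- The weak equation integrates to an identity of vectors, because the `k i` separate points. Its
  -- right side is strongly differentiable, the integrand being continuous.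
  have key : ∀ t, U t x - x = ∫ s in (0 : ℝ)..t, Complex.I • U s y := by
    intro t
    rw [← sub_eq_zero]
    refine hk _ fun i => ?_
    have h1 := (innerSL ℂ (k i)).intervalIntegral_comp_comm (hc'.intervalIntegrable (μ := volume) 0 t)
    simp only [innerSL_apply_apply] at h1
    have h2 := intervalIntegral.integral_eq_sub_of_hasDerivAt (a := 0) (b := t)
      (fun s _ => h i s)
      ((continuous_const.mul (continuous_const.inner hc)).intervalIntegrable (μ := volume) 0 t)
    rw [inner_sub_right, ← h1, inner_sub_right]
    simp only [inner_smul_right]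
    rw [h2, h0]
    simp
  have hd := intervalIntegral.integral_hasDerivAt_right (hc'.intervalIntegrable 0 0)
    (hc'.stronglyMeasurableAtFilter _ _) hc'.continuousAt
  rw [hasDerivAt_iff_tendsto_slope_zero] at hd
  simp only [h0] at hd
  refine hd.congr fun t => ?_
  rw [zero_add, intervalIntegral.integral_same, sub_zero, ← key, ← Complex.ofReal_inv,
    Complex.coe_smul]

/-- Strong continuity of isometries may be checked on a family with dense span. -/
theorem continuous_apply_of_dense_span {ι : Type*} {k : ι → E}
    (hk : (Submodule.span ℂ (Set.range k)).topologicalClosure = ⊤)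
    (h : ∀ i, Continuous fun t => U t (k i)) (x : E) : Continuous fun t => U t x := by
  have h1 : ∀ y ∈ Submodule.span ℂ (Set.range k), Continuous fun t => U t y := by
    intro y hy
    induction hy using Submodule.span_induction with
    | mem y hy => obtain ⟨i, rfl⟩ := hy; exact h i
    | zero => simpa using continuous_const
    | add y z _ _ hy hz => simpa only [map_add] using hy.fun_add hz
    | smul c y _ hy => simpa only [map_smul] using hy.fun_const_smul c
  -- As every `U t` is an isometry, `U t y` approximates `U t x` uniformly in `t` when `y` is close
  -- to `x`.
  refine continuous_of_uniform_approx_of_continuous fun u hu => ?_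
  obtain ⟨ε, hε, hεu⟩ := Metric.mem_uniformity_dist.1 hu
  have hx : x ∈ closure (Submodule.span ℂ (Set.range k) : Set E) := by
    have : x ∈ (Submodule.span ℂ (Set.range k)).topologicalClosure := by rw [hk]; trivial
    exact this
  obtain ⟨y, hy, hxy⟩ := Metric.mem_closure_iff.1 hx ε hε
  exact ⟨fun t => U t y, h1 y hy, fun t => hεu (by rwa [LinearIsometryEquiv.dist_map])⟩

end UnitaryGroups

/-! ### Translations, rotations and the mean value property for the Gaussian measure. -/

section Gaussian

variable {n : ℕ}

/-- The density of the Gaussian measure `μₙ`. -/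
def gaussianDensity (u : Fin n → ℂ) : ℝ := ∏ j, Real.exp (-‖u j‖ ^ 2) / Real.pi

lemma gaussianDensity_nonneg (u : Fin n → ℂ) : 0 ≤ gaussianDensity u := (bargmann_density_pos u).le

lemma continuous_gaussianDensity : Continuous (gaussianDensity (n := n)) :=
  bargmann_density_continuous n

lemma bargmannMeasure_eq :
    bargmannMeasure n = volume.withDensity fun u => ENNReal.ofReal (gaussianDensity u) := rfl

section

variable {E : Type*} [NormedAddCommGroup E] [NormedSpace ℝ E]

lemma integrable_bargmannMeasure_iff {φ : (Fin n → ℂ) → E} :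
    Integrable φ (bargmannMeasure n) ↔ Integrable (fun u => gaussianDensity u • φ u) := by
  rw [bargmannMeasure_eq, integrable_withDensity_iff_integrable_smul'
    continuous_gaussianDensity.measurable.ennreal_ofReal (by simp)]
  simp only [ENNReal.toReal_ofReal (gaussianDensity_nonneg _)]

lemma integral_bargmannMeasure (φ : (Fin n → ℂ) → E) :
    ∫ u, φ u ∂bargmannMeasure n = ∫ u, gaussianDensity u • φ u := by
  rw [bargmannMeasure_eq, integral_withDensity_eq_integral_toReal_smul
    continuous_gaussianDensity.measurable.ennreal_ofReal (by simp)]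
  simp only [ENNReal.toReal_ofReal (gaussianDensity_nonneg _)]

/-- The exponential is the weight that compensates a translation of the Gaussian measure. Both the
unitarity of the displacement operators and the reproducing property rest on it. -/
lemma gaussianDensity_add (u b : Fin n → ℂ) :
    gaussianDensity (u + b) =
      gaussianDensity u * Real.exp (∑ j, (-‖b j‖ ^ 2 - 2 * (conj (b j) * u j).re)) := by
  rw [gaussianDensity, gaussianDensity, Real.exp_sum, ← Finset.prod_mul_distrib]
  refine Finset.prod_congr rfl fun j _ => ?_
  rw [div_mul_eq_mul_div, ← Real.exp_add]
  congr 2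
  rw [← Complex.normSq_eq_norm_sq, ← Complex.normSq_eq_norm_sq, ← Complex.normSq_eq_norm_sq,
    Pi.add_apply, Complex.normSq_add]
  simp only [Complex.mul_re, Complex.conj_re, Complex.conj_im]
  ring

lemma integrable_bargmannMeasure_translate {φ : (Fin n → ℂ) → E}
    (h : Integrable φ (bargmannMeasure n)) (b : Fin n → ℂ) :
    Integrable (fun u => Real.exp (∑ j, (-‖b j‖ ^ 2 - 2 * (conj (b j) * u j).re)) • φ (u + b))
      (bargmannMeasure n) := by
  rw [integrable_bargmannMeasure_iff] at h ⊢
  refine (h.comp_add_right b).congr (Eventually.of_forall fun u => ?_)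
  simp only [gaussianDensity_add, mul_smul]

lemma integral_bargmannMeasure_translate (φ : (Fin n → ℂ) → E) (b : Fin n → ℂ) :
    ∫ u, Real.exp (∑ j, (-‖b j‖ ^ 2 - 2 * (conj (b j) * u j).re)) • φ (u + b) ∂bargmannMeasure n =
      ∫ u, φ u ∂bargmannMeasure n := by
  rw [integral_bargmannMeasure, integral_bargmannMeasure,
    ← integral_add_right_eq_self (fun u => gaussianDensity u • φ u) b]
  simp only [gaussianDensity_add, mul_smul]

end

lemma measurePreserving_bargmannMeasure {T : (Fin n → ℂ) → Fin n → ℂ}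
    (hT : MeasurePreserving T volume volume)
    (h : ∀ u, gaussianDensity (T u) = gaussianDensity u) :
    MeasurePreserving T (bargmannMeasure n) (bargmannMeasure n) := by
  refine ⟨hT.measurable, Measure.ext fun s hs => ?_⟩
  rw [Measure.map_apply hT.measurable hs, bargmannMeasure_eq,
    withDensity_apply _ (hT.measurable hs), withDensity_apply _ hs,
    ← hT.setLIntegral_comp_preimage hs continuous_gaussianDensity.measurable.ennreal_ofReal]
  simp only [h]

lemma measurePreserving_star_bargmannMeasure :
    MeasurePreserving (fun u : Fin n → ℂ => star u) (bargmannMeasure n) (bargmannMeasure n) :=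
  measurePreserving_bargmannMeasure (star_measurePreserving n) fun u => by simp [gaussianDensity]

lemma measurePreserving_circleMap_bargmannMeasure (θ : ℝ) :
    MeasurePreserving (fun u : Fin n → ℂ => circleMap 0 1 θ • u)
      (bargmannMeasure n) (bargmannMeasure n) := by
  refine measurePreserving_bargmannMeasure ?_ fun u => by simp [gaussianDensity]
  have h : (fun u : Fin n → ℂ => circleMap 0 1 θ • u) =
      fun u j => rotation (Circle.exp θ) (u j) := by
    funext u j
    simp [circleMap]
  rw [h]
  exact volume_preserving_pi (ι := Fin n) (f := fun _ z => rotation (Circle.exp θ) z)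
    fun _ => (rotation (Circle.exp θ)).measurePreserving

instance isProbabilityMeasure_bargmannMeasure : IsProbabilityMeasure (bargmannMeasure n) := by
  have h0 : ∫ z : ℂ, Real.exp (-‖z‖ ^ 2) = Real.pi := by
    simpa using GaussianFourier.integral_rexp_neg_mul_sq_norm (V := ℂ) one_pos
  have h1 : Integrable fun z : ℂ => Real.exp (-‖z‖ ^ 2) := by
    -- The integral of a non-integrable function is `0` by convention, so the nonzero value `π`
    -- forces integrability.
    by_contra h
    rw [integral_undef h] at h0
    exact Real.pi_ne_zero h0.symm
  have h2 : Integrable (gaussianDensity (n := n)) :=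
    Integrable.fintype_prod (f := fun _ (z : ℂ) => Real.exp (-‖z‖ ^ 2) / Real.pi)
      fun _ => h1.div_const _
  refine ⟨?_⟩
  rw [bargmannMeasure_eq, withDensity_apply _ MeasurableSet.univ, Measure.restrict_univ,
    ← ofReal_integral_eq_lintegral_ofReal h2 (Eventually.of_forall gaussianDensity_nonneg)]
  have h3 : ∫ u : Fin n → ℂ, gaussianDensity u = 1 := by
    refine (integral_fintype_prod_volume_eq_prod (ι := Fin n)
      fun _ (z : ℂ) => Real.exp (-‖z‖ ^ 2) / Real.pi).trans ?_
    simp [integral_div, h0, Real.pi_ne_zero]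
  rw [h3, ENNReal.ofReal_one]

/-- The mean value property of entire functions for the Gaussian measure. -/
theorem integral_bargmannMeasure_entire {F : (Fin n → ℂ) → ℂ} (hF : Differentiable ℂ F)
    (hint : Integrable F (bargmannMeasure n)) : ∫ u, F u ∂bargmannMeasure n = F 0 := by
  -- Average over the rotations `u ↦ e^{iθ} u`, which preserve the measure, and exchange the
  -- integrals: for fixed `u` the circle average of `ζ ↦ F (ζ • u)` is `F 0`.
  set I := Set.Ioc (0 : ℝ) (2 * Real.pi)
  have h2pi : (0 : ℝ) < 2 * Real.pi := by positivity
  have hmp := measurePreserving_circleMap_bargmannMeasure (n := n)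
  have hc : Continuous F := hF.continuous
  have hemb : ∀ θ, MeasurableEmbedding fun u : Fin n → ℂ => circleMap 0 1 θ • u := fun θ =>
    measurableEmbedding_const_smul₀ (circleMap_ne_center one_ne_zero)
  have hrot : ∀ θ, ∫ u, F (circleMap 0 1 θ • u) ∂bargmannMeasure n =
      ∫ u, F u ∂bargmannMeasure n := fun θ => (hmp θ).integral_comp (hemb θ) F
  have hnrot : ∀ θ, ∫ u, ‖F (circleMap 0 1 θ • u)‖ ∂bargmannMeasure n =
      ∫ u, ‖F u‖ ∂bargmannMeasure n := fun θ => (hmp θ).integral_comp (hemb θ) fun u => ‖F u‖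
  have hI : Integrable (Function.uncurry fun (θ : ℝ) (u : Fin n → ℂ) => F (circleMap 0 1 θ • u))
      ((volume.restrict I).prod (bargmannMeasure n)) := by
    refine (integrable_prod_iff ?_).2 ⟨Eventually.of_forall fun θ => ?_, ?_⟩
    · refine Continuous.aestronglyMeasurable ?_
      simp only [Function.uncurry_def]
      fun_prop
    · exact (hmp θ).integrable_comp_of_integrable hint
    · simp only [Function.uncurry_apply_pair, hnrot]
      exact integrable_const _
  have hswap := integral_integral_swap hI
  have hcirc : ∀ u : Fin n → ℂ, ∫ θ in I, F (circleMap 0 1 θ • u) = (2 * Real.pi : ℝ) • F 0 := by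
    intro u
    have hd : Differentiable ℂ fun ζ : ℂ => F (ζ • u) := by fun_prop
    have h := DiffContOnCl.circleAverage (f := fun ζ : ℂ => F (ζ • u)) (c := 0) (R := 1)
      hd.diffContOnCl
    rw [Real.circleAverage_def, intervalIntegral.integral_of_le h2pi.le, zero_smul] at h
    rw [← h, smul_smul, mul_inv_cancel₀ h2pi.ne', one_smul]
  simp only [hrot, hcirc, integral_const, probReal_univ, one_smul] at hswap
  rw [measureReal_restrict_apply_univ, Real.volume_real_Ioc_of_le h2pi.le, sub_zero] at hswap
  exact smul_right_injective ℂ h2pi.ne' hswap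

end Gaussian

/-! ### Coherent states and the reproducing kernel. -/

section HolomorphicSpace

variable {n : ℕ}

/-- By invariance of the measure under conjugation, norms and inner products can be computed with
the entire function itself instead of `u ↦ G (star u)`. -/
lemma memLp_entirePart (g : HolomorphicSpace n) : MemLp (entirePart g) 2 (bargmannMeasure n) := by
  have h : MemLp (fun u => entirePart g (star u)) 2 (bargmannMeasure n) :=
    (memLp_congr_ae (coeFn_ae_eq_entirePart g)).1 (Lp.memLp _)
  simpa [Function.comp_def] using h.comp_measurePreserving measurePreserving_star_bargmannMeasure

/-- The element of the holomorphic representation space given by a square integrable entire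
function. -/
def ofEntire (G : (Fin n → ℂ) → ℂ) (hG : Differentiable ℂ G) (h : MemLp G 2 (bargmannMeasure n)) :
    HolomorphicSpace n :=
  ⟨(h.comp_measurePreserving measurePreserving_star_bargmannMeasure).toLp
    (fun u => G (star u)), G, hG,
    MemLp.coeFn_toLp (h.comp_measurePreserving measurePreserving_star_bargmannMeasure)⟩

@[simp]
lemma entirePart_ofEntire (G : (Fin n → ℂ) → ℂ) (hG : Differentiable ℂ G)
    (h : MemLp G 2 (bargmannMeasure n)) : entirePart (ofEntire G hG h) = G :=
  entirePart_eq_of_ae_eq _ hG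
    (MemLp.coeFn_toLp (h.comp_measurePreserving measurePreserving_star_bargmannMeasure))

lemma integral_bargmannMeasure_star {E : Type*} [NormedAddCommGroup E] [NormedSpace ℝ E]
    (φ : (Fin n → ℂ) → E) :
    ∫ u, φ (star u) ∂bargmannMeasure n = ∫ u, φ u ∂bargmannMeasure n :=
  measurePreserving_star_bargmannMeasure.integral_comp
    (Homeomorph.measurableEmbedding ⟨⟨star, star, star_star, star_star⟩,
      continuous_star, continuous_star⟩) φ

lemma inner_eq_integral_entirePart (g h : HolomorphicSpace n) :
    inner ℂ g h = ∫ u, conj (entirePart g u) * entirePart h u ∂bargmannMeasure n := by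
  rw [Submodule.coe_inner, L2.inner_def]
  have h1 : ∫ u, inner ℂ ((g : Lp ℂ 2 (bargmannMeasure n)) u)
      ((h : Lp ℂ 2 (bargmannMeasure n)) u) ∂bargmannMeasure n =
      ∫ u, conj (entirePart g (star u)) * entirePart h (star u) ∂bargmannMeasure n := by
    refine integral_congr_ae ?_
    filter_upwards [coeFn_ae_eq_entirePart g, coeFn_ae_eq_entirePart h] with u h1 h2
    rw [h1, h2, RCLike.inner_apply, mul_comm]
  rw [h1]
  exact integral_bargmannMeasure_star fun u => conj (entirePart g u) * entirePart h u

lemma norm_sq_eq_integral_entirePart (g : HolomorphicSpace n) :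
    ‖g‖ ^ 2 = ∫ u, ‖entirePart g u‖ ^ 2 ∂bargmannMeasure n := by
  have h := (inner_self_eq_norm_sq_to_K (𝕜 := ℂ) g).symm.trans (inner_eq_integral_entirePart g g)
  simp only [Complex.conj_mul'] at h
  have h2 : ((‖g‖ ^ 2 : ℝ) : ℂ) =
      ((∫ u, ‖entirePart g u‖ ^ 2 ∂bargmannMeasure n : ℝ) : ℂ) := by
    rw [← integral_complex_ofReal]
    push_cast
    exact h
  exact_mod_cast h2

/-- The entire function `w ↦ exp (c · w)`. -/
def expLinear (c w : Fin n → ℂ) : ℂ := Complex.exp (∑ j, c j * w j)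

lemma differentiable_expLinear (c : Fin n → ℂ) : Differentiable ℂ (expLinear c) := by
  unfold expLinear
  fun_prop

lemma norm_expLinear (c w : Fin n → ℂ) : ‖expLinear c w‖ = Real.exp (∑ j, (c j * w j).re) := by
  rw [expLinear, Complex.norm_exp, Complex.re_sum]

/-- Up to the constant `e^{∑ |c_j|²}`, the squared modulus is the weight of the translation by
`-star c`. -/
lemma memLp_expLinear (c : Fin n → ℂ) : MemLp (expLinear c) 2 (bargmannMeasure n) := by
  rw [memLp_two_iff_integrable_sq_norm (differentiable_expLinear c).continuous.aestronglyMeasurable]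
  have h := integrable_bargmannMeasure_translate (integrable_const (1 : ℝ)) (-star c)
  refine (h.const_mul (Real.exp (∑ j, ‖c j‖ ^ 2))).congr (Eventually.of_forall fun u => ?_)
  simp only [smul_eq_mul, mul_one]
  rw [norm_expLinear, ← Real.exp_nat_mul, ← Real.exp_add, ← Finset.sum_add_distrib, Finset.mul_sum]
  congr 1
  refine Finset.sum_congr rfl fun j _ => ?_
  simp
  ring

/-- The coherent state `ū ↦ exp (c · ū)`. -/
def coherentState (c : Fin n → ℂ) : HolomorphicSpace n :=
  ofEntire (expLinear c) (differentiable_expLinear c) (memLp_expLinear c)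

@[simp]
lemma entirePart_coherentState (c : Fin n → ℂ) : entirePart (coherentState c) = expLinear c :=
  entirePart_ofEntire _ _ _

/-- Coherent states are reproducing kernels. -/
theorem inner_coherentState (c : Fin n → ℂ) (g : HolomorphicSpace n) :
    inner ℂ (coherentState c) g = entirePart g (star c) := by
  rw [inner_eq_integral_entirePart, entirePart_coherentState]
  have hint : Integrable (fun u => conj (expLinear c u) * entirePart g u) (bargmannMeasure n) :=
    MemLp.integrable_mul (memLp_expLinear c).star (memLp_entirePart g)
  -- After translation by `star c`, the weight turns the antiholomorphic factor into `e^{-c·u}`. The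
  -- integrand becomes entire, and its mean value is its value at `0`.
  have key : ∀ u, Real.exp (∑ j, (-‖star c j‖ ^ 2 - 2 * (conj (star c j) * u j).re)) •
      (conj (expLinear c (u + star c)) * entirePart g (u + star c)) =
      expLinear (-c) u * entirePart g (u + star c) := by
    intro u
    rw [← Complex.coe_smul, smul_eq_mul, ← mul_assoc]
    congr 1
    rw [expLinear, expLinear, ← Complex.exp_conj, Complex.ofReal_exp, ← Complex.exp_add]
    congr 1
    push_cast
    rw [map_sum, ← Finset.sum_add_distrib]
    refine Finset.sum_congr rfl fun j _ => ?_
    have h1 := Complex.add_conj (c j * u j)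
    have h2 := Complex.mul_conj' (c j)
    simp only [Pi.star_apply, RCLike.star_def, Complex.conj_conj, Pi.add_apply, map_mul, map_add,
      Pi.neg_apply, RCLike.norm_conj] at h1 h2 ⊢
    push_cast at h1
    linear_combination h1 + h2
  have h2 := integrable_bargmannMeasure_translate hint (star c)
  rw [← integral_bargmannMeasure_translate _ (star c)]
  simp only [key] at h2 ⊢
  rw [integral_bargmannMeasure_entire _ h2]
  · simp [expLinear]
  · have := differentiable_entirePart g
    have := differentiable_expLinear (-c)
    fun_prop

lemma conj_expLinear_star (z v : Fin n → ℂ) : conj (expLinear (star z) (star v)) = expLinear z v := by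
  simp [expLinear, ← Complex.exp_conj]

lemma integrable_reproducing_kernel (g : HolomorphicSpace n) (z : Fin n → ℂ) :
    Integrable (fun v => expLinear z v * entirePart g (star v)) (bargmannMeasure n) := by
  have hint : Integrable (fun u => conj (expLinear (star z) u) * entirePart g u)
      (bargmannMeasure n) :=
    MemLp.integrable_mul (memLp_expLinear _).star (memLp_entirePart g)
  have h := measurePreserving_star_bargmannMeasure.integrable_comp_of_integrable hint
  simpa only [Function.comp_def, conj_expLinear_star] using h

lemma integral_reproducing_kernel (g : HolomorphicSpace n) (z : Fin n → ℂ) :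
    ∫ v, expLinear z v * entirePart g (star v) ∂bargmannMeasure n = entirePart g z := by
  have h := inner_coherentState (star z) g
  rw [inner_eq_integral_entirePart, entirePart_coherentState, star_star,
    ← integral_bargmannMeasure_star] at h
  simpa only [conj_expLinear_star] using h

lemma eq_zero_of_inner_coherentState (g : HolomorphicSpace n)
    (h : ∀ c : Fin n → ℂ, inner ℂ (coherentState c) g = 0) : g = 0 := by
  apply entirePart_injective n
  rw [entirePart_zero]
  funext w
  have := h (star w)
  rwa [inner_coherentState, star_star] at this

lemma topologicalClosure_span_coherentState :
    (Submodule.span ℂ (Set.range (coherentState (n := n)))).topologicalClosure = ⊤ := by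
  rw [Submodule.topologicalClosure_eq_top_iff, Submodule.eq_bot_iff]
  intro g hg
  exact eq_zero_of_inner_coherentState g fun c =>
    (Submodule.mem_orthogonal _ _).1 hg _ (Submodule.subset_span ⟨c, rfl⟩)

/-- The inner products of coherent states are explicit exponentials, hence so are the terms of their
squared distances. -/
lemma continuous_coherentState : Continuous (coherentState (n := n)) := by
  have hI : ∀ c d : Fin n → ℂ, inner ℂ (coherentState c) (coherentState d) =
      expLinear d (star c) := fun c d => by
    rw [inner_coherentState, entirePart_coherentState]
  refine continuous_iff_continuousAt.2 fun c => ?_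
  rw [ContinuousAt, tendsto_iff_norm_sub_tendsto_zero]
  have h2 : Continuous fun d : Fin n → ℂ => ‖coherentState d - coherentState c‖ ^ 2 := by
    have h3 : ∀ d : Fin n → ℂ, ‖coherentState d - coherentState c‖ ^ 2 =
        (expLinear d (star d) - expLinear c (star d) - expLinear d (star c) +
          expLinear c (star c)).re := by
      intro d
      rw [← hI, ← hI, ← hI, ← hI, ← inner_self_eq_norm_sq (𝕜 := ℂ)]
      rw [inner_sub_left, inner_sub_right, inner_sub_right]
      simp only [RCLike.re_to_complex, Complex.sub_re, Complex.add_re]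
      ring
    simp only [h3, expLinear]
    fun_prop
  have h4 := (Real.continuous_sqrt.comp h2).tendsto c
  simpa only [Function.comp_def, sub_self, norm_zero, Real.sqrt_sq (norm_nonneg _),
    ne_eq, OfNat.ofNat_ne_zero, not_false_eq_true, zero_pow, Real.sqrt_zero] using h4

/-- The bound `|z| ≤ e^{Re z} + e^{-Re z} + e^{Im z} + e^{-Im z}` dominates the function by the
moduli of four exponentials, with `c_j` shifted by `±1` and `±i`. This puts coherent states in the
domain of `creation j`. -/
lemma memLp_coord_mul_expLinear (c : Fin n → ℂ) (j : Fin n) :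
    MemLp (fun w => w j * expLinear c w) 2 (bargmannMeasure n) := by
  have hbound : ∀ z : ℂ, ‖z‖ ≤ Real.exp z.re + Real.exp (-z.re) + Real.exp z.im +
      Real.exp (-z.im) := by
    intro z
    have habs : ∀ x : ℝ, |x| ≤ Real.exp x + Real.exp (-x) := fun x => by
      have h1 := Real.add_one_le_exp x
      have h2 := Real.add_one_le_exp (-x)
      have h3 := Real.exp_pos x
      have h4 := Real.exp_pos (-x)
      exact abs_le.2 ⟨by linarith, by linarith⟩
    linarith [Complex.norm_le_abs_re_add_abs_im z, habs z.re, habs z.im]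
  have hexp : ∀ (a : ℂ) (w : Fin n → ℂ), ‖expLinear (c + Pi.single j a) w‖ =
      Real.exp (a * w j).re * ‖expLinear c w‖ := by
    intro a w
    rw [norm_expLinear, norm_expLinear, ← Real.exp_add]
    congr 1
    simp only [Pi.add_apply, add_mul, Complex.add_re, Finset.sum_add_distrib]
    rw [add_comm]
    congr 1
    rw [Finset.sum_eq_single j (fun k _ hk => by simp [hk]) (by simp)]
    simp
  have hL := fun a : ℂ => (memLp_expLinear (c + Pi.single j a)).norm
  refine ((((hL 1).add (hL (-1))).add (hL (-Complex.I))).add (hL Complex.I)).mono' ?_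
    (Eventually.of_forall fun w => ?_)
  · have := (differentiable_expLinear c).continuous
    exact Continuous.aestronglyMeasurable (by fun_prop)
  · simp only [Pi.add_apply, hexp, norm_mul, ← add_mul]
    gcongr
    simpa using hbound (w j)

lemma fderiv_expLinear (c w v : Fin n → ℂ) :
    fderiv ℂ (expLinear c) w v = (∑ j, c j * v j) * expLinear c w := by
  have h1 : HasFDerivAt (fun w : Fin n → ℂ => ∑ j, c j * w j)
      (∑ j, c j • ContinuousLinearMap.proj (R := ℂ) (φ := fun _ : Fin n => ℂ) j) w :=
    HasFDerivAt.fun_sum fun j _ => (hasFDerivAt_apply j w).const_mul (c j)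
  have h2 : HasFDerivAt (expLinear c) _ w := h1.cexp
  rw [h2.fderiv]
  simp [expLinear, mul_comm]

lemma coherentState_mem_creation_domain (c : Fin n → ℂ) (j : Fin n) :
    coherentState c ∈ (creation j).domain := by
  refine ⟨ofEntire (fun w => w j * expLinear c w) ?_ (memLp_coord_mul_expLinear c j), ?_⟩
  · have := differentiable_expLinear c
    fun_prop
  · simp

lemma coherentState_mem_annihilation_domain (c : Fin n → ℂ) (j : Fin n) :
    coherentState c ∈ (annihilation j).domain := by
  refine ⟨c j • coherentState c, ?_⟩
  funext w
  simp [entirePart_smul, fderiv_expLinear, Pi.single_apply]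

end HolomorphicSpace

/-! ### The displacement group. -/

section Displacement

variable {n : ℕ}

/-- The action of the displacement operator `e^{itH}` on entire functions. -/
def displaceFun (f : Fin n → ℂ) (t : ℝ) (G : (Fin n → ℂ) → ℂ) (w : Fin n → ℂ) : ℂ :=
  Complex.exp (-(1 / 2) * (t : ℂ) ^ 2 * ∑ j, conj (f j) * f j) *
    expLinear f ((Complex.I * t) • w) * G (w + (Complex.I * t) • star f)

variable (f : Fin n → ℂ)

lemma differentiable_displaceFun (t : ℝ) {G : (Fin n → ℂ) → ℂ} (hG : Differentiable ℂ G) :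
    Differentiable ℂ (displaceFun f t G) := by
  have := differentiable_expLinear f
  unfold displaceFun
  fun_prop

lemma displaceFun_zero (G : (Fin n → ℂ) → ℂ) : displaceFun f 0 G = G := by
  funext w
  simp [displaceFun, expLinear]

/-- The factor `e^{it f·w}`, evaluated at `w + is f̄`, contributes `e^{-st|f|²}`, the cross term of
`e^{-(s+t)²|f|²/2}`. -/
lemma displaceFun_add (s t : ℝ) (G : (Fin n → ℂ) → ℂ) :
    displaceFun f (s + t) G = displaceFun f s (displaceFun f t G) := by
  funext w
  have h1 : w + (Complex.I * (s + t : ℝ)) • star f =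
      w + (Complex.I * s) • star f + (Complex.I * t) • star f := by
    push_cast
    module
  simp only [displaceFun, h1]
  rw [← mul_assoc]
  congr 1
  simp only [expLinear, ← Complex.exp_add]
  congr 1
  simp only [Finset.mul_sum, ← Finset.sum_add_distrib]
  refine Finset.sum_congr rfl fun j _ => ?_
  simp only [Pi.smul_apply, Pi.add_apply, Pi.star_apply, smul_eq_mul, RCLike.star_def]
  push_cast
  linear_combination (-(f j * conj (f j) * s * t)) * Complex.I_sq

/-- The squared modulus of the prefactors is exactly the weight of the translation by `it f̄` in
`gaussianDensity_add`, so isometry is a change of variables. -/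
lemma norm_displaceFun_sq (t : ℝ) (G : (Fin n → ℂ) → ℂ) (u : Fin n → ℂ) :
    ‖displaceFun f t G u‖ ^ 2 =
      Real.exp (∑ j, (-‖((Complex.I * t) • star f) j‖ ^ 2 -
        2 * (conj (((Complex.I * t) • star f) j) * u j).re)) •
      ‖G (u + (Complex.I * t) • star f)‖ ^ 2 := by
  rw [displaceFun, norm_mul, mul_pow, smul_eq_mul]
  congr 1
  rw [expLinear, ← Complex.exp_add, Complex.norm_exp, ← Real.exp_nat_mul]
  congr 1
  simp only [Finset.mul_sum, ← Finset.sum_add_distrib, Complex.re_sum]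
  refine Finset.sum_congr rfl fun j _ => ?_
  simp only [Pi.smul_apply, Pi.star_apply, smul_eq_mul, RCLike.star_def, norm_mul, RCLike.norm_conj,
    Complex.norm_I, Complex.norm_real, one_mul, mul_pow, Real.norm_eq_abs, sq_abs, map_mul,
    Complex.conj_I, Complex.conj_ofReal, Complex.conj_conj, Complex.conj_mul']
  have h1 : -(1 / 2) * (t : ℂ) ^ 2 * (‖f j‖ : ℂ) ^ 2 = ((-(1 / 2) * t ^ 2 * ‖f j‖ ^ 2 : ℝ) : ℂ) := by
    push_cast
    ring
  rw [Complex.add_re, h1, Complex.ofReal_re]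
  simp
  ring

lemma memLp_displaceFun (t : ℝ) {G : (Fin n → ℂ) → ℂ} (hG : Differentiable ℂ G)
    (h : MemLp G 2 (bargmannMeasure n)) : MemLp (displaceFun f t G) 2 (bargmannMeasure n) := by
  rw [memLp_two_iff_integrable_sq_norm
    (differentiable_displaceFun f t hG).continuous.aestronglyMeasurable]
  rw [memLp_two_iff_integrable_sq_norm hG.continuous.aestronglyMeasurable] at h
  simp only [norm_displaceFun_sq]
  exact integrable_bargmannMeasure_translate h _

/-- The displacement operator on the holomorphic representation space. -/
def displaceMap (t : ℝ) (g : HolomorphicSpace n) : HolomorphicSpace n :=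
  ofEntire (displaceFun f t (entirePart g))
    (differentiable_displaceFun f t (differentiable_entirePart g))
    (memLp_displaceFun f t (differentiable_entirePart g) (memLp_entirePart g))

@[simp]
lemma entirePart_displaceMap (t : ℝ) (g : HolomorphicSpace n) :
    entirePart (displaceMap f t g) = displaceFun f t (entirePart g) := entirePart_ofEntire _ _ _

lemma displaceMap_zero (g : HolomorphicSpace n) : displaceMap f 0 g = g := by
  apply entirePart_injective n
  rw [entirePart_displaceMap, displaceFun_zero]

lemma displaceMap_add (s t : ℝ) (g : HolomorphicSpace n) :
    displaceMap f (s + t) g = displaceMap f s (displaceMap f t g) := by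
  apply entirePart_injective n
  simp only [entirePart_displaceMap, displaceFun_add]

/-- The displacement operators as unitary operators. -/
def displacement (t : ℝ) : HolomorphicSpace n ≃ₗᵢ[ℂ] HolomorphicSpace n where
  toFun := displaceMap f t
  invFun := displaceMap f (-t)
  map_add' g h := by
    apply entirePart_injective n
    funext w
    simp only [entirePart_displaceMap, entirePart_add, displaceFun, Pi.add_apply]
    ring
  map_smul' c g := by
    apply entirePart_injective n
    funext w
    simp only [entirePart_displaceMap, entirePart_smul, displaceFun, Pi.smul_apply, smul_eq_mul,
      RingHom.id_apply]
    ring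
  left_inv g := by rw [← displaceMap_add, neg_add_cancel, displaceMap_zero]
  right_inv g := by rw [← displaceMap_add, add_neg_cancel, displaceMap_zero]
  norm_map' g := by
    refine (sq_eq_sq₀ (norm_nonneg _) (norm_nonneg _)).1 ?_
    change ‖displaceMap f t g‖ ^ 2 = ‖g‖ ^ 2
    rw [norm_sq_eq_integral_entirePart, norm_sq_eq_integral_entirePart, entirePart_displaceMap]
    simp only [norm_displaceFun_sq]
    exact integral_bargmannMeasure_translate (fun u => ‖entirePart g u‖ ^ 2) _

lemma entirePart_displacement (t : ℝ) (g : HolomorphicSpace n) :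
    entirePart (displacement f t g) = displaceFun f t (entirePart g) := entirePart_displaceMap f t g

lemma displacement_zero (g : HolomorphicSpace n) : displacement f 0 g = g := displaceMap_zero f g

lemma displacement_add (s t : ℝ) (g : HolomorphicSpace n) :
    displacement f (s + t) g = displacement f s (displacement f t g) := displaceMap_add f s t g

/-- Coherent states are mapped to multiples of coherent states, which reduces strong continuity to
`continuous_coherentState`. -/
lemma displacement_coherentState (t : ℝ) (c : Fin n → ℂ) :
    displacement f t (coherentState c) =
      (Complex.exp (-(1 / 2) * (t : ℂ) ^ 2 * ∑ j, conj (f j) * f j) *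
        expLinear c ((Complex.I * t) • star f)) •
      coherentState (c + (Complex.I * t) • f) := by
  apply entirePart_injective n
  funext w
  rw [entirePart_displacement, entirePart_smul, entirePart_coherentState, entirePart_coherentState,
    Pi.smul_apply, displaceFun, smul_eq_mul]
  generalize Complex.exp (-(1 / 2) * (t : ℂ) ^ 2 * ∑ j, conj (f j) * f j) = C
  rw [mul_assoc, mul_assoc]
  congr 1
  simp only [expLinear, ← Complex.exp_add, ← Finset.sum_add_distrib]
  congr 1
  refine Finset.sum_congr rfl fun j _ => ?_
  simp only [Pi.smul_apply, Pi.add_apply, smul_eq_mul]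
  ring

lemma continuous_displacement (g : HolomorphicSpace n) : Continuous fun t => displacement f t g := by
  refine continuous_apply_of_dense_span topologicalClosure_span_coherentState (fun c => ?_) g
  simp only [displacement_coherentState]
  have h : Continuous fun t : ℝ => c + (Complex.I * t) • f := by fun_prop
  have h1 := (differentiable_expLinear c).continuous
  have h2 : Continuous fun t : ℝ => Complex.exp (-(1 / 2) * (t : ℂ) ^ 2 * ∑ j, conj (f j) * f j) *
      expLinear c ((Complex.I * t) • star f) := by fun_prop
  exact h2.smul (continuous_coherentState.comp h)

/-! ### The generator and the self-adjointness of the Hamiltonian. -/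

/-- The differential expression `∑ⱼ (fⱼ wⱼ + f̄ⱼ ∂ⱼ)` of the linear Hamiltonian. -/
def hamiltonianFun (G : (Fin n → ℂ) → ℂ) (w : Fin n → ℂ) : ℂ :=
  (∑ j, f j * w j) * G w + fderiv ℂ G w (star f)

/-- The derivative `-t|f|²` of the Gaussian exponent is accounted for by the multiplier `f·w` taken
at the shifted point `w + it f̄`. No square integrability enters. -/
lemma hasDerivAt_displaceFun {G : (Fin n → ℂ) → ℂ} (hG : Differentiable ℂ G) (w : Fin n → ℂ)
    (t : ℝ) : HasDerivAt (fun s => displaceFun f s G w)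
      (Complex.I * displaceFun f t (hamiltonianFun f G) w) t := by
  have hid : HasDerivAt (fun s : ℝ => (s : ℂ)) 1 t := Complex.ofRealCLM.hasDerivAt
  have h1 : HasDerivAt
      (fun s : ℝ => Complex.exp (-(1 / 2) * (s : ℂ) ^ 2 * ∑ j, conj (f j) * f j)) _ t :=
    (((hid.fun_pow 2).const_mul _).mul_const _).cexp
  have h2 : HasDerivAt (fun s : ℝ => Complex.exp (s * (Complex.I * ∑ j, f j * w j))) _ t :=
    (hid.mul_const _).cexp
  have h3 : HasDerivAt (fun s : ℝ => w + (s : ℂ) • (Complex.I • star f)) _ t :=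
    (hid.smul_const _).const_add w
  have h4 : HasDerivAt (fun s : ℝ => G (w + (s : ℂ) • (Complex.I • star f))) _ t :=
    ((hG _).hasFDerivAt.restrictScalars ℝ).comp_hasDerivAt t h3
  have he : ∀ s : ℝ, expLinear f ((Complex.I * s) • w) =
      Complex.exp (s * (Complex.I * ∑ j, f j * w j)) := by
    intro s
    rw [expLinear]
    congr 1
    simp only [Finset.mul_sum, Pi.smul_apply, smul_eq_mul]
    exact Finset.sum_congr rfl fun j _ => by ring
  have hs : ∀ s : ℝ, (Complex.I * s) • star f = (s : ℂ) • (Complex.I • star f) := fun s => by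
    rw [smul_smul, mul_comm]
  simp only [displaceFun, he, hs, hamiltonianFun]
  refine ((h1.fun_mul h2).fun_mul h4).congr_deriv ?_
  have h5 : ∑ j, f j * (w + (t : ℂ) • (Complex.I • star f)) j =
      ∑ j, f j * w j + Complex.I * t * ∑ j, conj (f j) * f j := by
    simp only [Finset.mul_sum, ← Finset.sum_add_distrib]
    refine Finset.sum_congr rfl fun j _ => ?_
    simp only [Pi.add_apply, Pi.smul_apply, Pi.star_apply, smul_eq_mul, RCLike.star_def]
    ring
  rw [h5]
  simp only [one_smul, one_mul, ContinuousLinearMap.coe_restrictScalars', map_smul, smul_eq_mul]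
  push_cast
  set A := Complex.exp (-(1 / 2) * (t : ℂ) ^ 2 * ∑ j, conj (f j) * f j)
  set B := Complex.exp (t * (Complex.I * ∑ j, f j * w j))
  set S := ∑ j, conj (f j) * f j
  set P := G (w + (t : ℂ) • (Complex.I • star f))
  linear_combination (-(A * B * t * S * P)) * Complex.I_sq

/-- The generator of the displacement group is the differential expression `hamiltonianFun f` with
its maximal domain. -/
theorem hasGenerator_displacement_iff {g h : HolomorphicSpace n} :
    HasGenerator (displacement f) g h ↔ entirePart h = hamiltonianFun f (entirePart g) := by
  constructor
  · intro hgh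
    funext w
    have h1 := hgh.hasDerivAt (displacement_add f) 0
    have h2 := (hasDerivAt_const (0 : ℝ) (coherentState (star w))).inner ℂ h1
    simp only [inner_coherentState, entirePart_displacement, star_star, inner_zero_left, add_zero,
      inner_smul_right, displaceFun_zero] at h2
    have h3 := hasDerivAt_displaceFun f (differentiable_entirePart g) w 0
    rw [displaceFun_zero] at h3
    exact mul_left_cancel₀ Complex.I_ne_zero (h2.unique h3)
  · intro hgh
    -- Pointwise derivatives are weak derivatives against the coherent states, and `h` is a vector
    -- realizing them.
    refine hasGenerator_of_inner (displacement_zero f) eq_zero_of_inner_coherentState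
      (continuous_displacement f h) fun c t => ?_
    simp only [inner_coherentState, entirePart_displacement, hgh]
    exact hasDerivAt_displaceFun f (differentiable_entirePart g) (star c) t

lemma hamiltonianFun_add {F G : (Fin n → ℂ) → ℂ} (hF : Differentiable ℂ F)
    (hG : Differentiable ℂ G) :
    hamiltonianFun f (F + G) = hamiltonianFun f F + hamiltonianFun f G := by
  funext w
  simp only [hamiltonianFun, Pi.add_apply, fderiv_add (hF w) (hG w), add_apply]
  ring

lemma hamiltonianFun_smul (c : ℂ) {F : (Fin n → ℂ) → ℂ} (hF : Differentiable ℂ F) :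
    hamiltonianFun f (c • F) = c • hamiltonianFun f F := by
  funext w
  simp only [hamiltonianFun, Pi.smul_apply, fderiv_const_smul (hF w), smul_apply, smul_eq_mul]
  ring

/-- The graph of the maximal operator of the differential expression `hamiltonianFun f`. -/
def hamiltonianGraph : Submodule ℂ (HolomorphicSpace n × HolomorphicSpace n) where
  carrier := {p | entirePart p.2 = hamiltonianFun f (entirePart p.1)}
  zero_mem' := by
    have := hamiltonianFun_smul f 0 (differentiable_const (0 : ℂ))
    simp only [zero_smul] at this
    simp [entirePart_zero, this]
  add_mem' {p q} hp hq := by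
    simp only [Set.mem_ofPred_eq, Prod.fst_add, Prod.snd_add, entirePart_add] at hp hq ⊢
    rw [hp, hq, hamiltonianFun_add f (differentiable_entirePart _) (differentiable_entirePart _)]
  smul_mem' c p hp := by
    simp only [Set.mem_ofPred_eq, Prod.smul_fst, Prod.smul_snd, entirePart_smul] at hp ⊢
    rw [hp, hamiltonianFun_smul f c (differentiable_entirePart _)]

lemma mem_hamiltonianGraph_iff {g h : HolomorphicSpace n} :
    (g, h) ∈ hamiltonianGraph f ↔ entirePart h = hamiltonianFun f (entirePart g) := Iff.rfl

/-- Symmetry comes from the unitary group: its elements are exactly the pairs of the generator of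
`displacement f`. -/
lemma hamiltonianGraph_le_adjoint : hamiltonianGraph f ≤ (hamiltonianGraph f).adjoint := by
  rintro ⟨x, y⟩ hxy
  rw [Submodule.mem_adjoint_iff]
  intro a b hab
  rw [mem_hamiltonianGraph_iff, ← hasGenerator_displacement_iff] at hxy hab
  rw [hab.inner_symm (displacement_zero f) (displacement_add f) hxy, sub_self]

/-- The sum of unbounded operators whose closure is the linear Hamiltonian. -/
def preHamiltonian : HolomorphicSpace n →ₗ.[ℂ] HolomorphicSpace n :=
  ∑ j, (f j • creation j + conj (f j) • annihilation j)

lemma LinearPMap.mem_sum_domain {E F ι : Type*} [AddCommGroup E] [Module ℂ E] [AddCommGroup F]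
    [Module ℂ F] {T : ι → E →ₗ.[ℂ] F} {x : E} (s : Finset ι) (h : ∀ i ∈ s, x ∈ (T i).domain) :
    x ∈ (∑ i ∈ s, T i).domain := by
  classical
  induction s using Finset.induction_on with
  | empty => exact Submodule.mem_top
  | insert a s ha ih =>
    rw [Finset.sum_insert ha]
    exact ⟨h a (Finset.mem_insert_self a s), ih fun i hi => h i (Finset.mem_insert_of_mem hi)⟩

lemma coherentState_mem_preHamiltonian_domain (c : Fin n → ℂ) :
    coherentState c ∈ (preHamiltonian f).domain :=
  LinearPMap.mem_sum_domain _ fun j _ =>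
    ⟨coherentState_mem_creation_domain c j, coherentState_mem_annihilation_domain c j⟩

lemma dense_preHamiltonian_domain :
    Dense ((preHamiltonian f).domain : Set (HolomorphicSpace n)) := by
  rw [Submodule.dense_iff_topologicalClosure_eq_top, eq_top_iff,
    ← topologicalClosure_span_coherentState]
  refine Submodule.topologicalClosure_mono (Submodule.span_le.2 ?_)
  rintro _ ⟨c, rfl⟩
  exact coherentState_mem_preHamiltonian_domain f c

lemma entirePart_creation (j : Fin n) (g : (creation (n := n) j).domain) (w : Fin n → ℂ) :
    entirePart (creation j g) w = w j * entirePart (g : HolomorphicSpace n) w :=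
  congrFun (entirePart_maximalOperator (fun G w => w j * G w) _ _ g) w

lemma entirePart_annihilation (j : Fin n) (g : (annihilation (n := n) j).domain) (w : Fin n → ℂ) :
    entirePart (annihilation j g) w =
      fderiv ℂ (entirePart (g : HolomorphicSpace n)) w (Pi.single j 1) :=
  congrFun (entirePart_maximalOperator (fun G w => fderiv ℂ G w (Pi.single j 1)) _ _ g) w

lemma entirePart_ladder (a b : ℂ) (j : Fin n)
    (g : (a • creation j + b • annihilation j).domain) (w : Fin n → ℂ) :
    entirePart ((a • creation j + b • annihilation j) g) w =
      a * (w j * entirePart (g : HolomorphicSpace n) w) +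
        b * fderiv ℂ (entirePart (g : HolomorphicSpace n)) w (Pi.single j 1) := by
  obtain ⟨g, hg⟩ := g
  rw [← entirePart_creation j ⟨g, hg.1⟩, ← entirePart_annihilation j ⟨g, hg.2⟩]
  change entirePart (a • creation j ⟨g, hg.1⟩ + b • annihilation j ⟨g, hg.2⟩) w = _
  rw [entirePart_add, entirePart_smul, entirePart_smul]
  rfl

/-- Graph membership replaces application of the operator because the domain of the partial sum
changes at each induction step. -/
lemma entirePart_sum_apply {ι : Type*} {T : ι → HolomorphicSpace n →ₗ.[ℂ] HolomorphicSpace n}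
    {D : ι → HolomorphicSpace n → (Fin n → ℂ) → ℂ}
    (hT : ∀ i (g : (T i).domain), entirePart (T i g) = D i g) (s : Finset ι)
    (g h : HolomorphicSpace n) (hgh : (g, h) ∈ (∑ i ∈ s, T i).graph) :
    entirePart h = ∑ i ∈ s, D i g := by
  classical
  induction s using Finset.induction_on generalizing h with
  | empty =>
    rw [Finset.sum_empty] at hgh ⊢
    obtain ⟨g', -, rfl⟩ := (LinearPMap.mem_graph_iff _).1 hgh
    exact entirePart_zero n
  | insert a s ha ih =>
    rw [Finset.sum_insert ha] at hgh ⊢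
    obtain ⟨⟨g', h1, h2⟩, rfl, rfl⟩ := (LinearPMap.mem_graph_iff _).1 hgh
    rw [← ih _ ((∑ i ∈ s, T i).mem_graph ⟨g', h2⟩), ← hT a ⟨g', h1⟩, ← entirePart_add]
    rfl

lemma graph_preHamiltonian_le : (preHamiltonian f).graph ≤ hamiltonianGraph f := by
  rintro ⟨g, h⟩ hgh
  have h1 := entirePart_sum_apply (D := fun j g w => f j * (w j * entirePart g w) +
    conj (f j) * fderiv ℂ (entirePart g) w (Pi.single j 1))
    (fun j g => funext (entirePart_ladder (f j) (conj (f j)) j g))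
    Finset.univ g h hgh
  rw [mem_hamiltonianGraph_iff, h1]
  funext w
  rw [Finset.sum_apply]
  rw [hamiltonianFun, Finset.sum_add_distrib, Finset.sum_mul]
  congr 1
  · exact Finset.sum_congr rfl fun j _ => by ring
  -- Expanding `star f` in the standard basis turns the directional derivative into `∑ f̄_j ∂_j`.
  · conv_rhs => rw [← Finset.univ_sum_single (star f), map_sum]
    refine Finset.sum_congr rfl fun j _ => ?_
    rw [← smul_eq_mul, ← map_smul, ← Pi.single_smul, smul_eq_mul, mul_one]
    rfl

/-- Testing the adjoint against coherent states recovers the differential expression. -/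
lemma adjoint_graph_preHamiltonian_le :
    (preHamiltonian f).graph.adjoint ≤ hamiltonianGraph f := by
  rintro ⟨x, y⟩ hxy
  rw [mem_hamiltonianGraph_iff]
  rw [Submodule.mem_adjoint_iff] at hxy
  funext w
  obtain ⟨b, hmem⟩ :=
    LinearPMap.mem_domain_iff.1 (coherentState_mem_preHamiltonian_domain f (star w))
  have h1 := sub_eq_zero.1 (hxy _ _ hmem)
  have h2 : HasGenerator (displacement f) (coherentState (star w)) b :=
    (hasGenerator_displacement_iff f).2
      ((mem_hamiltonianGraph_iff f).1 (graph_preHamiltonian_le f hmem))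
  -- The derivative at `0` of `(U t x)(w) = ⟨coherentState (star w), U t x⟩` is computed twice:
  -- moving the generator onto the coherent state gives `i y(w)`, differentiating pointwise gives
  -- `i` times the differential expression of `x` at `w`.
  have h3 := h2.hasDerivAt_inner (displacement_zero f) (displacement_add f) x
  simp only [inner_coherentState, entirePart_displacement, star_star] at h3
  have h4 := h3.unique (hasDerivAt_displaceFun f (differentiable_entirePart x) w 0)
  rw [h1, inner_coherentState, star_star, displaceFun_zero] at h4
  exact mul_left_cancel₀ Complex.I_ne_zero h4

lemma isSelfAdjoint_linearHamiltonian_and_graph :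
    IsSelfAdjoint (linearHamiltonian f) ∧ (linearHamiltonian f).graph = hamiltonianGraph f :=
  LinearPMap.isSelfAdjoint_closure_of_adjoint_le (dense_preHamiltonian_domain f)
    (graph_preHamiltonian_le f) (hamiltonianGraph_le_adjoint f) (adjoint_graph_preHamiltonian_le f)

lemma isUnitaryGroupExp_displacement :
    IsUnitaryGroupExp (linearHamiltonian f) (displacement f) where
  map_zero := displacement_zero f
  map_add := displacement_add f
  continuous_apply := continuous_displacement f
  generator x y := by
    rw [(isSelfAdjoint_linearHamiltonian_and_graph f).2, mem_hamiltonianGraph_iff]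
    exact (hasGenerator_displacement_iff f).symm

end Displacement

/-! ### Uniqueness of the group and its integral kernel. -/

/-- A densely defined operator generates at most one unitary group. -/
theorem IsUnitaryGroupExp.unique {E : Type*} [NormedAddCommGroup E] [InnerProductSpace ℂ E]
    {H : E →ₗ.[ℂ] E} (hH : Dense (H.domain : Set E)) {U V : ℝ → E ≃ₗᵢ[ℂ] E}
    (hU : IsUnitaryGroupExp H U) (hV : IsUnitaryGroupExp H V) : V = U :=
  unitaryGroup_unique hU.map_zero hU.map_add hV.map_zero hV.map_add hH
    (fun x hx => ⟨H ⟨x, hx⟩, (hU.generator _ _).1 (H.mem_graph ⟨x, hx⟩),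
      (hV.generator _ _).1 (H.mem_graph ⟨x, hx⟩)⟩)
    fun x y h => (hU.generator x y).1 ((hV.generator x y).2 h)

/-- The terms of the exponent containing `v` form the reproducing kernel at `ū + it f̄`; the
remaining factors do not depend on `v` and are those of `displaceFun`. -/
lemma hasIntegralKernel_displacement {n : ℕ} (f : Fin n → ℂ) (t : ℝ) :
    HasIntegralKernel (displacement f t) fun w v =>
      Complex.exp (-(1 / 2) * (t : ℂ) ^ 2 * ∑ j, conj (f j) * f j) *
        Complex.exp (∑ j, (w j * v j + Complex.I * t * conj (f j) * v j
          + Complex.I * t * f j * w j)) := by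
  intro g u
  set C := Complex.exp (-(1 / 2) * (t : ℂ) ^ 2 * ∑ j, conj (f j) * f j) with hC
  have key : (fun v => C * Complex.exp (∑ j, (star u j * v j + Complex.I * t * conj (f j) * v j
      + Complex.I * t * f j * star u j)) * entirePart g (star v)) = fun v =>
      (C * expLinear f ((Complex.I * t) • star u)) *
        (expLinear (star u + (Complex.I * t) • star f) v * entirePart g (star v)) := by
    funext v
    rw [← mul_assoc]
    congr 1
    rw [mul_assoc]
    congr 1
    rw [expLinear, expLinear, ← Complex.exp_add, ← Finset.sum_add_distrib]
    congr 1
    refine Finset.sum_congr rfl fun j _ => ?_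
    simp only [Pi.smul_apply, Pi.add_apply, Pi.star_apply, smul_eq_mul, RCLike.star_def]
    ring
  beta_reduce
  rw [key]
  refine ⟨(integrable_reproducing_kernel g _).const_mul _, ?_⟩
  rw [integral_const_mul, integral_reproducing_kernel, entirePart_displacement]
  rfl

end

theorem theorem4p3 (n : ℕ) (f : Fin n → ℂ) :
    IsSelfAdjoint (linearHamiltonian f) ∧
    ∃ U : ℝ → HolomorphicSpace n ≃ₗᵢ[ℂ] HolomorphicSpace n,
      IsUnitaryGroupExp (linearHamiltonian f) U ∧
      (∀ V : ℝ → HolomorphicSpace n ≃ₗᵢ[ℂ] HolomorphicSpace n,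
        IsUnitaryGroupExp (linearHamiltonian f) V → V = U) ∧
      ∀ t : ℝ, HasIntegralKernel (U t) fun w v =>
        Complex.exp (-(1 / 2) * (t : ℂ) ^ 2 * ∑ j, conj (f j) * f j) *
          Complex.exp (∑ j, (w j * v j + Complex.I * t * conj (f j) * v j
            + Complex.I * t * f j * w j)) := by
  have hsa := (isSelfAdjoint_linearHamiltonian_and_graph f).1
  exact ⟨hsa, displacement f, isUnitaryGroupExp_displacement f,
    fun V hV => (isUnitaryGroupExp_displacement f).unique hsa.dense_domain hV,
    hasIntegralKernel_displacement f⟩
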